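/- Say that $G:\mathbb{R}\to[0,\infty)$ has property $\mathcal{P}$ if: (1) $G$ is nonzero, nondecreasing and convex on $[0,\infty)$; (2) $G(0)=0$, $G(1)=1$ and $G(-x)=G(x)$ for all $x$; (3) there is $s>0$ with $G(x)=sx+(1-s)$ for all $x>1$; (4) $G$ is twice differentiable on $(0,\delta_G)$ for some $\delta_G>0$, the right derivative $G'_+(0)$ exists in $\mathbb{R}$, the limit $G''_+(0)=\lim_{h\to0^+}(G'(h)-G'_+(0))/h$ exists (the value $+\infty$ being allowed), and $G'_+(0)>0$ or $G''_+(0)>0$; (5) there is $C_G>0$ such that for all $0<x<y$ one has $G(x)>0$ and $G(y)/G(x)\le C_G\,(y/x)^2$. For $v\in\mathbb{R}^n$ let $\|v\|_G=\inf\{\alpha>0 : \sum_{i=1}^n G(|v_i|/\alpha)\le 1\}$ be the Orlicz norm and $\|v\|_\infty=\max_i|v_i|$. There is an absolute constant $c>0$ such that for every $G$ with property $\mathcal{P}$ there is a constant $\alpha'_G\ge 1$, depending only on $G$, for which the following holds. Let $n\ge 2$, let $A\in\mathbb{R}^{n\times m}$ have rank $d$, and let $D\in\mathbb{R}^{n\times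 n}$ be a random diagonal matrix whose diagonal entries are i.i.d. real random variables with CDF $t\mapsto 1-e^{-G(t)}$ for $t\ge 0$ (and $0$ for $t<0$). Then, with probability at least $0.98$, $$\forall x\in\mathbb{R}^m,\qquad \frac{c}{\alpha'_G\, d\log n}\,\|Ax\|_G\;\le\;\|D^{-1}Ax\|_\infty .$$ (If $d=0$, then $Ax=0$ for all $x$ and the left-hand side is read as $0$.) -/

import Mathlib

open MeasureTheory ProbabilityTheory Filter Topology

/-- The Orlicz norm `‖x‖_G = inf {α > 0 | ∑ i, G (|x i| / α) ≤ 1}` of a vector `x ∈ ℝⁿ`. -/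
noncomputable def orliczNorm (G : ℝ → ℝ) {n : ℕ} (x : Fin n → ℝ) : ℝ :=
  sInf {α : ℝ | 0 < α ∧ ∑ i, G (|x i| / α) ≤ 1}

/-- Property `𝒫` of a function `G : ℝ → ℝ₊` (that `G` is nonzero is part of `G 1 = 1`). -/
structure PropertyP (G : ℝ → ℝ) : Prop where
  nonneg : ∀ x, 0 ≤ G x
  monotone : MonotoneOn G (Set.Ici 0)
  convex : ConvexOn ℝ (Set.Ici 0) G
  map_zero : G 0 = 0
  map_one : G 1 = 1
  even : ∀ x, G (-x) = G x
  linear : ∃ s : ℝ, 0 < s ∧ ∀ x, 1 < x → G x = s * x + (1 - s)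
  /-- `G` is twice differentiable on some interval `(0, δ)`. -/
  twice_diff : ∃ δ : ℝ, 0 < δ ∧ DifferentiableOn ℝ G (Set.Ioo 0 δ) ∧
    DifferentiableOn ℝ (deriv G) (Set.Ioo 0 δ)
  /-- `g₁ = G'₊(0)` and `g₂ = G''₊(0) = lim_{h → 0⁺} (G'(h) - G'₊(0)) / h` exist and one of them
  is positive. The value `g₂ = +∞` is allowed, as for `G x = |x| ^ p` on `[-1, 1]`,
  `1 < p < 2`. -/
  right_derivs : ∃ (g₁ : ℝ) (g₂ : EReal), HasDerivWithinAt G g₁ (Set.Ioi 0) 0 ∧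
    Tendsto (fun h : ℝ => (((deriv G h - g₁) / h : ℝ) : EReal)) (𝓝[>] 0) (𝓝 g₂) ∧
    (0 < g₁ ∨ 0 < g₂)
  /-- Subquadratic growth; the quotient presupposes `G x ≠ 0`. -/
  growth : ∃ C : ℝ, 0 < C ∧ ∀ x y : ℝ, 0 < x → x < y →
    0 < G x ∧ G y / G x ≤ C * (y / x) ^ 2

/-- The real random variable `u` has the distribution with CDF `1 - exp (-G t)` for `t ≥ 0`
(and `0` for `t < 0`). -/
def HasOrliczExpCDF {Ω : Type*} [MeasurableSpace Ω] (μ : Measure Ω) (G : ℝ → ℝ)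
    (u : Ω → ℝ) : Prop :=
  Measurable u ∧ ∀ t : ℝ, cdf (μ.map u) t = if 0 ≤ t then 1 - Real.exp (-G t) else 0

/-! For a fixed nonzero y, independence turns the probability that every `u i` exceeds `|y i| * t`
into `exp (-∑ i, G (|y i| * t))`. At `t = 2 / ‖y‖_G` the sum exceeds 1, and convexity with `G 0 = 0`
gives `G (K x) ≥ K G x`, so at `t = 2 K / ‖y‖_G` the probability is at most `exp (-K)`
(`le_sum_apply_mul`, `measureReal_iInter_gt`).

With `K = 30 d log n` this beats a union bound over a net of radius `n ^ (-20)` on the sup-norm unit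
sphere of the column space (`exists_net_unitSphere`, `card_mul_exp_le`). With probability 0.99 also
every `u i` exceeds `1 / (100 n)`, so passing from the net to the whole sphere costs little
(`orliczNorm_le_of_net`); homogeneity does the rest. Hence `α' = 1` suffices. -/

open Module Metric

/-! ### Nets on unit spheres -/

section Net

variable {E : Type*} [NormedAddCommGroup E] [NormedSpace ℝ E] [FiniteDimensional ℝ E]

/-- Volumetric bound for an `ε`-separated subset of the unit ball. -/
theorem card_le_of_separated_unitBall {ε : ℝ} (hε : 0 < ε) (hε1 : ε ≤ 1) (s : Finset E)
    (hs : ∀ c ∈ s, ‖c‖ ≤ 1) (h : ∀ c ∈ s, ∀ d ∈ s, c ≠ d → ε ≤ ‖c - d‖) :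
    (s.card : ℝ) ≤ (3 / ε) ^ finrank ℝ E := by
  borelize E
  let μ : Measure E := Measure.addHaar
  have hδ : 0 < ε / 2 := half_pos hε
  have hdisj : Set.Pairwise (s : Set E) (Function.onFun Disjoint fun c => ball c (ε / 2)) := by
    rintro c hc d hd hcd
    apply ball_disjoint_ball
    rw [dist_eq_norm]
    linarith [h c hc d hd hcd]
  -- The radius is `1 + ε / 2 ≤ 3 / 2`.
  have hsub : (⋃ c ∈ s, ball c (ε / 2)) ⊆ ball (0 : E) (3 / 2) := by
    refine Set.iUnion₂_subset fun x hx => ?_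
    apply ball_subset_ball'
    rw [dist_zero_right]
    linarith [hs x hx]
  have hvol : (s.card : ENNReal) * ENNReal.ofReal ((ε / 2) ^ finrank ℝ E) * μ (ball 0 1) ≤
      ENNReal.ofReal ((3 / 2) ^ finrank ℝ E) * μ (ball 0 1) :=
    calc
      _ = μ (⋃ c ∈ s, ball c (ε / 2)) := by
        rw [measure_biUnion_finset hdisj fun c _ => measurableSet_ball]
        simp only [μ.addHaar_ball_of_pos _ hδ, Finset.sum_const, nsmul_eq_mul, mul_assoc]
      _ ≤ μ (ball (0 : E) (3 / 2)) := measure_mono hsub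
      _ = _ := by rw [μ.addHaar_ball_of_pos _ (by norm_num)]
  have hcard : (s.card : ENNReal) * ENNReal.ofReal ((ε / 2) ^ finrank ℝ E) ≤
      ENNReal.ofReal ((3 / 2) ^ finrank ℝ E) :=
    (ENNReal.mul_le_mul_iff_left (measure_ball_pos _ _ zero_lt_one).ne' measure_ball_lt_top.ne).1
      hvol
  have hreal := ENNReal.toReal_le_of_le_ofReal (by positivity) hcard
  rw [ENNReal.toReal_mul, ENNReal.toReal_natCast, ENNReal.toReal_ofReal (by positivity)] at hreal
  rw [show (3 / ε : ℝ) = (3 / 2) / (ε / 2) by field_simp, div_pow, le_div_iff₀ (by positivity)]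
  exact hreal

/-- The unit sphere of a `d`-dimensional normed space has an `ε`-net with at most `(3 / ε) ^ d`
points. -/
theorem exists_net_unitSphere {ε : ℝ} (hε : 0 < ε) (hε1 : ε ≤ 1) :
    ∃ s : Finset E, (∀ c ∈ s, ‖c‖ = 1) ∧ (s.card : ℝ) ≤ (3 / ε) ^ finrank ℝ E ∧
      ∀ x : E, ‖x‖ = 1 → ∃ c ∈ s, ‖x - c‖ ≤ ε := by
  classical
  let P : Finset E → Prop := fun s =>
    (∀ c ∈ s, ‖c‖ = 1) ∧ ∀ c ∈ s, ∀ d ∈ s, c ≠ d → ε ≤ ‖c - d‖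
  have hbound : ∀ s, P s → (s.card : ℝ) ≤ (3 / ε) ^ finrank ℝ E := fun s hs =>
    card_le_of_separated_unitBall hε hε1 s (fun c hc => (hs.1 c hc).le) hs.2
  have hbdd : BddAbove {k : ℕ | ∃ s, P s ∧ s.card = k} := by
    refine ⟨⌊(3 / ε) ^ finrank ℝ E⌋₊, ?_⟩
    rintro _ ⟨s, hs, rfl⟩
    exact Nat.le_floor (hbound s hs)
  -- A separated set of maximal cardinality is a net: an uncovered point could be added to it.
  obtain ⟨s, hs, hmax⟩ := Nat.sSup_mem (s := {k : ℕ | ∃ s, P s ∧ s.card = k})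
    ⟨0, ∅, by simp [P], rfl⟩ hbdd
  refine ⟨s, hs.1, hbound s hs, fun x hx => ?_⟩
  by_contra! hfar
  have hxs : x ∉ s := fun hxs => by
    have := hfar x hxs
    simp only [sub_self, norm_zero] at this
    linarith
  have hP : P (insert x s) := by
    refine ⟨fun c hc => ?_, fun c hc d hd hcd => ?_⟩
    · rcases Finset.mem_insert.1 hc with rfl | hc
      exacts [hx, hs.1 c hc]
    · rcases Finset.mem_insert.1 hc with rfl | hc <;> rcases Finset.mem_insert.1 hd with rfl | hd
      · exact absurd rfl hcd
      · exact (hfar d hd).le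
      · rw [norm_sub_rev]
        exact (hfar c ‹_›).le
      · exact hs.2 c hc d hd hcd
  have hle := le_csSup hbdd ⟨_, hP, rfl⟩
  rw [← hmax, Finset.card_insert_of_notMem hxs] at hle
  omega

end Net

/-! ### Convexity of `G` and the Orlicz norm -/

namespace PropertyP

variable {G : ℝ → ℝ} {n : ℕ}

theorem apply_mul_le (hG : PropertyP G) {x t : ℝ} (hx : 0 ≤ x) (ht : 0 ≤ t) (ht1 : t ≤ 1) :
    G (t * x) ≤ t * G x := by
  have h := hG.convex.2 (Set.mem_Ici.2 hx) (Set.mem_Ici.2 le_rfl) ht (sub_nonneg.2 ht1)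
    (by ring)
  simpa [hG.map_zero] using h

theorem mul_apply_le (hG : PropertyP G) {x K : ℝ} (hx : 0 ≤ x) (hK : 1 ≤ K) :
    K * G x ≤ G (K * x) := by
  have hK0 : 0 < K := by linarith
  have h := hG.apply_mul_le (x := K * x) (t := K⁻¹) (by positivity) (by positivity)
    (inv_le_one_of_one_le₀ hK)
  rw [inv_mul_cancel_left₀ hK0.ne'] at h
  calc K * G x ≤ K * (K⁻¹ * G (K * x)) := by gcongr
    _ = G (K * x) := mul_inv_cancel_left₀ hK0.ne' _

theorem one_lt_apply (hG : PropertyP G) {x : ℝ} (hx : 1 < x) : 1 < G x := by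
  obtain ⟨s, hs, h⟩ := hG.linear
  rw [h x hx]
  nlinarith

theorem apply_le_self (hG : PropertyP G) {x : ℝ} (hx : 0 ≤ x) (hx1 : x ≤ 1) : G x ≤ x := by
  simpa [hG.map_one] using hG.apply_mul_le zero_le_one hx hx1

/-- Each term is at most `1 / n`, as `G t ≤ t` on `[0, 1]`. This bounds the Orlicz norm by `n` times
the sup norm. -/
theorem sum_apply_le_one_of_norm_mul_le (hG : PropertyP G) {x : Fin n → ℝ} {α : ℝ} (hα : 0 < α)
    (h : n * ‖x‖ ≤ α) : ∑ i, G (|x i| / α) ≤ 1 := by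
  have hle : ∀ i, G (|x i| / α) ≤ 1 / n := fun i => by
    have hn : (0 : ℝ) < n := by exact_mod_cast i.pos
    have hxi : |x i| / α ≤ 1 / n := by
      rw [div_le_div_iff₀ hα hn]
      have := norm_le_pi_norm x i
      rw [Real.norm_eq_abs] at this
      nlinarith
    refine (hG.apply_le_self (by positivity) (hxi.trans ?_)).trans hxi
    rw [div_le_one hn]
    exact_mod_cast i.pos
  calc ∑ i, G (|x i| / α) ≤ ∑ _i : Fin n, (1 / n : ℝ) := Finset.sum_le_sum fun i _ => hle i
    _ ≤ 1 := by
      simp only [Finset.sum_const, Finset.card_univ, Fintype.card_fin, nsmul_eq_mul]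
      rw [mul_one_div]
      exact div_self_le_one _

theorem orliczNorm_le {x : Fin n → ℝ} {α : ℝ} (hα : 0 < α) (h : ∑ i, G (|x i| / α) ≤ 1) :
    orliczNorm G x ≤ α :=
  csInf_le ⟨0, fun _ hb => hb.1.le⟩ ⟨hα, h⟩

/-- Since `G` is monotone, the set of admissible `α` is upward closed; a strict inequality avoids
asking whether the infimum is attained. -/
theorem sum_apply_le_one_of_orliczNorm_lt (hG : PropertyP G) {x : Fin n → ℝ} {α : ℝ}
    (h : orliczNorm G x < α) : 0 < α ∧ ∑ i, G (|x i| / α) ≤ 1 := by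
  have hne : {α : ℝ | 0 < α ∧ ∑ i, G (|x i| / α) ≤ 1}.Nonempty :=
    have hpos : 0 < n * ‖x‖ + 1 := by positivity
    ⟨n * ‖x‖ + 1, hpos, hG.sum_apply_le_one_of_norm_mul_le hpos (by linarith)⟩
  obtain ⟨β, ⟨hβ, hsum⟩, hβα⟩ := exists_lt_of_csInf_lt hne h
  refine ⟨hβ.trans hβα, (Finset.sum_le_sum fun i _ => ?_).trans hsum⟩
  exact hG.monotone (Set.mem_Ici.2 (by have := hβ.trans hβα; positivity))
    (Set.mem_Ici.2 (by positivity)) (by gcongr)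

theorem orliczNorm_add_le (hG : PropertyP G) (x y : Fin n → ℝ) :
    orliczNorm G (x + y) ≤ orliczNorm G x + orliczNorm G y := by
  refine le_of_forall_pos_le_add fun ε hε => ?_
  obtain ⟨hα, hx⟩ := hG.sum_apply_le_one_of_orliczNorm_lt
    (show orliczNorm G x < orliczNorm G x + ε / 2 by linarith)
  obtain ⟨hβ, hy⟩ := hG.sum_apply_le_one_of_orliczNorm_lt
    (show orliczNorm G y < orliczNorm G y + ε / 2 by linarith)
  set α := orliczNorm G x + ε / 2
  set β := orliczNorm G y + ε / 2
  -- Convexity with weights `α / (α + β)` and `β / (α + β)`.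
  have hle : ∀ i, G (|(x + y) i| / (α + β)) ≤
      α / (α + β) * G (|x i| / α) + β / (α + β) * G (|y i| / β) := fun i => by
    have hconv := hG.convex.2 (Set.mem_Ici.2 (by positivity : 0 ≤ |x i| / α))
      (Set.mem_Ici.2 (by positivity : 0 ≤ |y i| / β)) (by positivity : 0 ≤ α / (α + β))
      (by positivity : 0 ≤ β / (α + β)) (by field_simp)
    refine le_trans (hG.monotone (Set.mem_Ici.2 (by positivity)) (Set.mem_Ici.2 ?_) ?_) hconv
    · simp only [smul_eq_mul]
      positivity
    · calc |(x + y) i| / (α + β) ≤ (|x i| + |y i|) / (α + β) := by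
            gcongr
            exact abs_add_le _ _
        _ = α / (α + β) * (|x i| / α) + β / (α + β) * (|y i| / β) := by field_simp
  have hsum : ∑ i, G (|(x + y) i| / (α + β)) ≤ 1 :=
    calc ∑ i, G (|(x + y) i| / (α + β))
        ≤ α / (α + β) * ∑ i, G (|x i| / α) + β / (α + β) * ∑ i, G (|y i| / β) := by
          rw [Finset.mul_sum, Finset.mul_sum, ← Finset.sum_add_distrib]
          exact Finset.sum_le_sum fun i _ => hle i
      _ ≤ α / (α + β) * 1 + β / (α + β) * 1 := by gcongr
      _ = 1 := by field_simp
  have := orliczNorm_le (add_pos hα hβ) hsum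
  simp only [α, β] at this
  linarith

theorem orliczNorm_smul_le (hG : PropertyP G) {a : ℝ} (ha : 0 < a) (x : Fin n → ℝ) :
    orliczNorm G (a • x) ≤ a * orliczNorm G x := by
  rw [← div_le_iff₀' ha]
  refine le_of_forall_gt_imp_ge_of_dense fun α hα => ?_
  obtain ⟨hα0, hsum⟩ := hG.sum_apply_le_one_of_orliczNorm_lt hα
  rw [div_le_iff₀' ha]
  refine orliczNorm_le (by positivity) (le_of_eq_of_le ?_ hsum)
  refine Finset.sum_congr rfl fun i _ => ?_
  rw [Pi.smul_apply, smul_eq_mul, abs_mul, abs_of_pos ha, mul_div_mul_left _ _ ha.ne']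

theorem orliczNorm_zero (hG : PropertyP G) : orliczNorm G (0 : Fin n → ℝ) = 0 := by
  have h : {α : ℝ | 0 < α ∧ ∑ i, G (|(0 : Fin n → ℝ) i| / α) ≤ 1} = Set.Ioi 0 := by
    ext α
    simp [hG.map_zero]
  rw [orliczNorm, h, csInf_Ioi]

/-- A coordinate larger than `α` alone pushes the sum above 1, as `G > 1` beyond 1. -/
theorem norm_le_orliczNorm (hG : PropertyP G) (x : Fin n → ℝ) : ‖x‖ ≤ orliczNorm G x := by
  refine le_of_forall_gt_imp_ge_of_dense fun α hα => ?_
  obtain ⟨hα0, hsum⟩ := hG.sum_apply_le_one_of_orliczNorm_lt hα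
  refine (pi_norm_le_iff_of_nonneg hα0.le).2 fun i => ?_
  by_contra! hlt
  rw [Real.norm_eq_abs] at hlt
  have h1 := hG.one_lt_apply ((one_lt_div hα0).2 hlt)
  have h2 := Finset.single_le_sum (f := fun i => G (|x i| / α)) (fun j _ => hG.nonneg _)
    (Finset.mem_univ i)
  linarith

/-- Dividing the Orlicz norm by `2 K` raises the value of the Orlicz sum above `K`. -/
theorem le_sum_apply_mul (hG : PropertyP G) {x : Fin n → ℝ} (hx : x ≠ 0) {K : ℝ} (hK : 1 ≤ K) :
    K ≤ ∑ i, G (|x i| * (2 * K / orliczNorm G x)) := by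
  have hpos : 0 < orliczNorm G x := (norm_pos_iff.2 hx).trans_le (hG.norm_le_orliczNorm x)
  have hlt : 1 < ∑ i, G (|x i| / (orliczNorm G x / 2)) := by
    by_contra! h
    have := orliczNorm_le (half_pos hpos) h
    linarith
  calc K ≤ K * ∑ i, G (|x i| / (orliczNorm G x / 2)) := le_mul_of_one_le_right (by linarith) hlt.le
    _ ≤ ∑ i, G (|x i| * (2 * K / orliczNorm G x)) := by
      rw [Finset.mul_sum]
      refine Finset.sum_le_sum fun i _ => (hG.mul_apply_le (by positivity) hK).trans_eq ?_
      congr 1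
      field_simp

end PropertyP

/-! ### Tail probabilities and the union bound -/

section Probability

variable {Ω : Type*} [MeasurableSpace Ω] {μ : Measure Ω} [IsProbabilityMeasure μ] {G : ℝ → ℝ}

theorem HasOrliczExpCDF.measureReal_le {u : Ω → ℝ} (hu : HasOrliczExpCDF μ G u) {t : ℝ}
    (ht : 0 ≤ t) : μ.real {ω | u ω ≤ t} = 1 - Real.exp (-G t) := by
  have : IsProbabilityMeasure (μ.map u) := Measure.isProbabilityMeasure_map hu.1.aemeasurable
  have h := hu.2 t
  rw [if_pos ht, cdf_eq_real, map_measureReal_apply hu.1 measurableSet_Iic] at h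
  exact h

theorem HasOrliczExpCDF.measureReal_gt {u : Ω → ℝ} (hu : HasOrliczExpCDF μ G u) {t : ℝ}
    (ht : 0 ≤ t) : μ.real {ω | t < u ω} = Real.exp (-G t) := by
  have h := measureReal_compl (μ := μ) (s := {ω | u ω ≤ t}) (measurableSet_le hu.1 measurable_const)
  rw [hu.measureReal_le ht, probReal_univ] at h
  have hset : {ω | u ω ≤ t}ᶜ = {ω | t < u ω} := by
    ext ω
    simp
  rw [← hset, h]
  ring

theorem measureReal_iInter_gt {n : ℕ} {u : Fin n → Ω → ℝ} (hu : ∀ i, HasOrliczExpCDF μ G (u i))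
    (hind : iIndepFun u μ) {t : Fin n → ℝ} (ht : ∀ i, 0 ≤ t i) :
    μ.real (⋂ i, {ω | t i < u i ω}) = Real.exp (-∑ i, G (t i)) := by
  have h := hind.measure_inter_preimage_eq_mul Finset.univ (sets := fun i => Set.Ioi (t i))
    fun i _ => measurableSet_Ioi
  have hset : (⋂ i ∈ Finset.univ, u i ⁻¹' Set.Ioi (t i)) = ⋂ i, {ω | t i < u i ω} := by
    ext ω
    simp
  rw [hset] at h
  rw [measureReal_def, h, ENNReal.toReal_prod, ← Finset.sum_neg_distrib, Real.exp_sum]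
  exact Finset.prod_congr rfl fun i _ => (hu i).measureReal_gt (ht i)

/-- With probability at least `0.98`, all `u i` are bounded below by `1 / (100 n)`, and every `y` in
the finite set `N` has a coordinate witnessing a large weighted sup norm. -/
theorem measureReal_forall_net_ge (hG : PropertyP G) {n : ℕ} (hn : 0 < n) {u : Fin n → Ω → ℝ}
    (hu : ∀ i, HasOrliczExpCDF μ G (u i)) (hind : iIndepFun u μ) {ι : Type*} (N : Finset ι)
    (v : ι → Fin n → ℝ) (hv : ∀ y ∈ N, v y ≠ 0) {K : ℝ} (hK : 1 ≤ K)
    (hcard : N.card * Real.exp (-K) ≤ 0.01) :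
    0.98 ≤ μ.real {ω | (∀ i, 1 / (100 * n) < u i ω) ∧
      ∀ y ∈ N, ∃ i, u i ω ≤ |v y i| * (2 * K / orliczNorm G (v y))} := by
  have hn' : (1 : ℝ) ≤ n := by exact_mod_cast hn
  set S := {ω | (∀ i, 1 / (100 * n) < u i ω) ∧
      ∀ y ∈ N, ∃ i, u i ω ≤ |v y i| * (2 * K / orliczNorm G (v y))}
  set B₁ := ⋃ i, {ω | u i ω ≤ 1 / (100 * n)}
  set B₂ := ⋃ y ∈ N, ⋂ i, {ω | |v y i| * (2 * K / orliczNorm G (v y)) < u i ω}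
  have hB₁ : μ.real B₁ ≤ 0.01 :=
    calc μ.real B₁ ≤ ∑ i, μ.real {ω | u i ω ≤ 1 / (100 * n)} := measureReal_iUnion_fintype_le _
      _ ≤ ∑ _i : Fin n, (1 / (100 * n) : ℝ) := by
        refine Finset.sum_le_sum fun i _ => ?_
        rw [(hu i).measureReal_le (by positivity)]
        -- `1 - exp (-G t) ≤ G t ≤ t` at `t = 1 / (100 n)`.
        have h1 := Real.add_one_le_exp (-G (1 / (100 * n)))
        have h2 : G (1 / (100 * n)) ≤ 1 / (100 * n) := by
          refine hG.apply_le_self (by positivity) ?_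
          rw [div_le_one (by positivity)]
          linarith
        linarith
      _ = 0.01 := by
        simp only [Finset.sum_const, Finset.card_univ, Fintype.card_fin, nsmul_eq_mul]
        field_simp
        norm_num
  have hB₂ : μ.real B₂ ≤ 0.01 :=
    calc μ.real B₂
        ≤ ∑ y ∈ N, μ.real (⋂ i, {ω | |v y i| * (2 * K / orliczNorm G (v y)) < u i ω}) :=
          measureReal_biUnion_finset_le _ _
      _ ≤ ∑ _y ∈ N, Real.exp (-K) := by
        refine Finset.sum_le_sum fun y hy => ?_
        have hpos : 0 ≤ orliczNorm G (v y) := (norm_nonneg _).trans (hG.norm_le_orliczNorm _)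
        rw [measureReal_iInter_gt hu hind fun i => by positivity]
        exact Real.exp_le_exp.2 (neg_le_neg (hG.le_sum_apply_mul (hv y hy) hK))
      _ ≤ 0.01 := by simpa using hcard
  have hcover : (Set.univ : Set Ω) ⊆ S ∪ (B₁ ∪ B₂) := fun ω _ => by
    by_contra h
    simp only [Set.mem_union, not_or] at h
    obtain ⟨hS, h₁, h₂⟩ := h
    refine hS ⟨fun i => ?_, fun y hy => ?_⟩
    · by_contra! hi
      exact h₁ (Set.mem_iUnion.2 ⟨i, hi⟩)
    · by_contra! hy'
      exact h₂ (Set.mem_iUnion₂.2 ⟨y, hy, Set.mem_iInter.2 hy'⟩)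
  have h1 : μ.real Set.univ ≤ _ := measureReal_mono hcover
  have h2 := measureReal_union_le (μ := μ) S (B₁ ∪ B₂)
  have h3 := measureReal_union_le (μ := μ) B₁ B₂
  rw [probReal_univ] at h1
  norm_num at hB₁ hB₂ ⊢
  linarith

end Probability

/-! ### From the net to the column space -/

theorem mulVec_diagonal_inv {n : ℕ} {u : Fin n → ℝ} (hu : ∀ i, 0 < u i) (y : Fin n → ℝ) :
    (Matrix.diagonal u)⁻¹.mulVec y = fun i => y i / u i := by
  have hinv : (Matrix.diagonal u)⁻¹ = Matrix.diagonal fun i => (u i)⁻¹ := by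
    refine Matrix.inv_eq_right_inv ?_
    rw [Matrix.diagonal_mul_diagonal, ← Matrix.diagonal_one]
    congr 1
    funext i
    exact mul_inv_cancel₀ (hu i).ne'
  ext i
  rw [hinv, Matrix.mulVec_diagonal, div_eq_inv_mul]

/-- The deterministic step from the net to all of `V`. -/
theorem orliczNorm_le_of_net {G : ℝ → ℝ} (hG : PropertyP G) {n : ℕ} {u : Fin n → ℝ}
    (hn : 0 < n) (hu : ∀ i, 1 / (100 * n) < u i) {K ε : ℝ} (hK : 1 ≤ K) (hε : 0 < ε)
    (hKε : 2 * (n * ε) + 400 * (n * ε) * K ≤ 1) (V : Submodule ℝ (Fin n → ℝ)) (N : Finset V)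
    (hN : ∀ x : V, ‖x‖ = 1 → ∃ y ∈ N, ‖x - y‖ ≤ ε)
    (hyN : ∀ y ∈ N, ‖y‖ = 1)
    (h : ∀ y ∈ N, ∃ i, u i ≤ |(y : Fin n → ℝ) i| * (2 * K / orliczNorm G (y : Fin n → ℝ)))
    {x : Fin n → ℝ} (hx : x ∈ V) :
    orliczNorm G x / (4 * K) ≤ ‖fun i => x i / u i‖ := by
  have hn' : (1 : ℝ) ≤ n := by exact_mod_cast hn
  have hu0 : ∀ i, 0 < u i := fun i => lt_of_le_of_lt (by positivity) (hu i)
  have hsphere : ∀ z : V, ‖z‖ = 1 →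
      orliczNorm G (z : Fin n → ℝ) / (4 * K) ≤ ‖fun i => (z : Fin n → ℝ) i / u i‖ := by
    intro z hz
    obtain ⟨y, hy, hzy⟩ := hN z hz
    obtain ⟨i, hi⟩ := h y hy
    have hynorm : 1 ≤ orliczNorm G (y : Fin n → ℝ) := by
      have := hG.norm_le_orliczNorm (y : Fin n → ℝ)
      rwa [← Submodule.coe_norm, hyN y hy] at this
    have hznorm : 1 ≤ orliczNorm G (z : Fin n → ℝ) := by
      have := hG.norm_le_orliczNorm (z : Fin n → ℝ)
      rwa [← Submodule.coe_norm, hz] at this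
    have hsub : ‖(z : Fin n → ℝ) - (y : Fin n → ℝ)‖ ≤ ε := hzy
    have htri : orliczNorm G (z : Fin n → ℝ) ≤ n * ε + orliczNorm G (y : Fin n → ℝ) := by
      have h1 := hG.orliczNorm_add_le ((z : Fin n → ℝ) - (y : Fin n → ℝ)) y
      rw [sub_add_cancel] at h1
      have h2 : orliczNorm G ((z : Fin n → ℝ) - (y : Fin n → ℝ)) ≤ n * ε :=
        PropertyP.orliczNorm_le (by positivity)
          (hG.sum_apply_le_one_of_norm_mul_le (by positivity) (by gcongr))
      linarith
    have hcoord : |(z : Fin n → ℝ) i - (y : Fin n → ℝ) i| ≤ ε :=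
      (norm_le_pi_norm ((z : Fin n → ℝ) - (y : Fin n → ℝ)) i).trans hsub
    have hyi : orliczNorm G (y : Fin n → ℝ) / (2 * K) ≤ |(y : Fin n → ℝ) i| / u i := by
      rw [div_le_div_iff₀ (by positivity) (hu0 i)]
      rw [← mul_div_assoc, le_div_iff₀ (by positivity)] at hi
      linarith
    have hdiff : |(z : Fin n → ℝ) i - (y : Fin n → ℝ) i| / u i ≤ 100 * (n * ε) := by
      rw [div_le_iff₀ (hu0 i)]
      have := (div_lt_iff₀ (by positivity)).1 (hu i)
      nlinarith
    have habs : |(y : Fin n → ℝ) i| / u i ≤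
        |(z : Fin n → ℝ) i| / u i + |(z : Fin n → ℝ) i - (y : Fin n → ℝ) i| / u i := by
      rw [← add_div]
      have := hu0 i
      gcongr
      rw [abs_sub_comm]
      have := abs_add_le ((z : Fin n → ℝ) i) ((y : Fin n → ℝ) i - (z : Fin n → ℝ) i)
      rwa [add_sub_cancel] at this
    have hfin : |(z : Fin n → ℝ) i| / u i ≤ ‖fun i => (z : Fin n → ℝ) i / u i‖ := by
      have := norm_le_pi_norm (fun i => (z : Fin n → ℝ) i / u i) i
      rwa [Real.norm_eq_abs, abs_div, abs_of_pos (hu0 i)] at this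
    refine le_trans ?_ hfin
    have hz2 : orliczNorm G (z : Fin n → ℝ) / (2 * K) ≤
        n * ε / (2 * K) + orliczNorm G (y : Fin n → ℝ) / (2 * K) := by
      rw [← add_div]
      gcongr
    -- Both errors together use up at most half of the bound `‖z‖_G / (2 K)`, because `‖z‖_G ≥ 1`.
    have hsmall : n * ε / (2 * K) + 100 * (n * ε) ≤ orliczNorm G (z : Fin n → ℝ) / (4 * K) := by
      rw [le_div_iff₀ (by positivity)]
      have : (n * ε / (2 * K) + 100 * (n * ε)) * (4 * K) =
          2 * (n * ε) + 400 * (n * ε) * K := by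
        field_simp
        ring
      linarith
    have hhalf : orliczNorm G (z : Fin n → ℝ) / (2 * K) =
        2 * (orliczNorm G (z : Fin n → ℝ) / (4 * K)) := by
      field_simp
      norm_num
    linarith
  rcases eq_or_ne x 0 with rfl | hx0
  · simp [hG.orliczNorm_zero]
  have hxpos : 0 < ‖x‖ := norm_pos_iff.2 hx0
  have hz := hsphere (‖x‖⁻¹ • ⟨x, hx⟩) (by
    rw [norm_smul, Submodule.coe_norm, norm_inv, norm_norm, inv_mul_cancel₀ hxpos.ne'])
  have hscale := hG.orliczNorm_smul_le hxpos (‖x‖⁻¹ • x)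
  rw [smul_inv_smul₀ hxpos.ne'] at hscale
  have heq : (fun i => (‖x‖⁻¹ • x) i / u i) = ‖x‖⁻¹ • fun i => x i / u i := by
    ext i
    simp [mul_div_assoc]
  rw [Submodule.coe_smul, heq, norm_smul, norm_inv, norm_norm] at hz
  calc orliczNorm G x / (4 * K) ≤ ‖x‖ * orliczNorm G (‖x‖⁻¹ • x) / (4 * K) := by gcongr
    _ = ‖x‖ * (orliczNorm G (‖x‖⁻¹ • x) / (4 * K)) := mul_div_assoc _ _ _
    _ ≤ ‖x‖ * (‖x‖⁻¹ * ‖fun i => x i / u i‖) := by gcongr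
    _ = ‖fun i => x i / u i‖ := mul_inv_cancel_left₀ hxpos.ne' _

/-- The net costs `(3 n ^ 20) ^ d` and the tail gains `n ^ (-30 d)`, leaving `(3 / n ^ 10) ^ d`,
where `3 / 2 ^ 10 < 0.01`. -/
theorem card_mul_exp_le {n d : ℕ} (hn : 2 ≤ n) (hd : 0 < d) {k : ℝ}
    (hk : k ≤ (3 / (1 / (n : ℝ) ^ 20)) ^ d) :
    k * Real.exp (-(30 * (d * Real.log n))) ≤ 0.01 := by
  have hn' : (2 : ℝ) ≤ n := by exact_mod_cast hn
  have hn0 : (0 : ℝ) < n := by linarith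
  have hexp : Real.exp (-(30 * (d * Real.log n))) = (1 / (n : ℝ) ^ 30) ^ d := by
    rw [one_div, ← Real.exp_log (pow_pos hn0 30), ← Real.exp_neg, ← Real.exp_nat_mul, Real.log_pow]
    congr 1
    push_cast
    ring
  have hratio : 3 / (n : ℝ) ^ 10 ≤ 0.01 := by
    rw [div_le_iff₀ (by positivity)]
    have : (2 : ℝ) ^ 10 ≤ (n : ℝ) ^ 10 := by gcongr
    norm_num at this ⊢
    linarith
  rw [hexp]
  calc k * (1 / (n : ℝ) ^ 30) ^ d ≤ (3 / (1 / (n : ℝ) ^ 20)) ^ d * (1 / (n : ℝ) ^ 30) ^ d := by gcongr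
    _ = (3 / (n : ℝ) ^ 10) ^ d := by
      rw [← mul_pow]
      congr 1
      field_simp
    _ ≤ 3 / (n : ℝ) ^ 10 := pow_le_of_le_one (by positivity) (hratio.trans (by norm_num)) hd.ne'
    _ ≤ 0.01 := hratio

theorem net_radius_bound {n d : ℕ} (hn : 2 ≤ n) (hdn : d ≤ n) :
    2 * (n * (1 / (n : ℝ) ^ 20)) + 400 * (n * (1 / (n : ℝ) ^ 20)) * (30 * (d * Real.log n)) ≤ 1 := by
  have hn' : (2 : ℝ) ≤ n := by exact_mod_cast hn
  have hn0 : (0 : ℝ) < n := by linarith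
  have hd' : (d : ℝ) ≤ n := by exact_mod_cast hdn
  have hlog : Real.log n ≤ n := (Real.log_le_sub_one_of_pos hn0).trans (by linarith)
  have hlog0 : 0 ≤ Real.log n := Real.log_nonneg (by linarith)
  have hpow : (2 : ℝ) ^ 17 ≤ (n : ℝ) ^ 17 := by gcongr
  have hnn : (1 : ℝ) ≤ n * n := by nlinarith
  calc _ ≤ 2 * (n * (1 / (n : ℝ) ^ 20)) * (n * n) +
        400 * (n * (1 / (n : ℝ) ^ 20)) * (30 * (n * n)) := by
        refine add_le_add (le_mul_of_one_le_right (by positivity) hnn) ?_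
        gcongr
    _ = 12002 / (n : ℝ) ^ 17 := by
      field_simp
      norm_num
    _ ≤ 1 := by
      rw [div_le_one (by positivity)]
      norm_num at hpow
      linarith

/-! ### The main theorem -/

theorem theorem12 :
    ∃ c : ℝ, 0 < c ∧ ∀ G : ℝ → ℝ, PropertyP G →
      ∃ α' : ℝ, 1 ≤ α' ∧
        ∀ (n m d : ℕ) (_ : 2 ≤ n) (A : Matrix (Fin n) (Fin m) ℝ) (_ : A.rank = d)
          (Ω : Type*) [MeasurableSpace Ω] (μ : Measure Ω) [IsProbabilityMeasure μ]
          (u : Fin n → Ω → ℝ) (_ : ∀ i, HasOrliczExpCDF μ G (u i)) (_ : iIndepFun u μ),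
          0.98 ≤ μ.real {ω | ∀ x : Fin m → ℝ,
            c / (α' * d * Real.log n) * orliczNorm G (A.mulVec x) ≤
              ‖(Matrix.diagonal (fun i => u i ω))⁻¹.mulVec (A.mulVec x)‖} := by
  -- `120 = 4 * 30`, from the loss `4 K` with `K = 30 d log n`.
  refine ⟨1 / 120, by norm_num, fun G hG => ⟨1, le_rfl, ?_⟩⟩
  intro n m d hn A hA Ω _ μ _ u hu hind
  -- For `d = 0` the coefficient is a division by zero, hence 0.
  rcases Nat.eq_zero_or_pos d with rfl | hd
  · simp only [Nat.cast_zero, mul_zero, zero_mul, div_zero, norm_nonneg, implies_true,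
      Set.ofPred_true, probReal_univ]
    norm_num
  have hlog : Real.log 2 ≤ Real.log n := Real.log_le_log (by norm_num) (by exact_mod_cast hn)
  have hlog2 := Real.log_two_gt_d9
  have hd' : (1 : ℝ) ≤ d := by exact_mod_cast hd
  have hn' : (1 : ℝ) ≤ n := by exact_mod_cast (by omega : 1 ≤ n)
  have hK : 1 ≤ 30 * (d * Real.log n) := by nlinarith
  let V := LinearMap.range A.mulVecLin
  have hV : finrank ℝ V = d := hA
  obtain ⟨N, hN1, hNcard, hNnet⟩ := exists_net_unitSphere (E := V) (ε := 1 / (n : ℝ) ^ 20)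
    (by positivity) (div_le_one_of_le₀ (one_le_pow₀ hn') (by positivity))
  rw [hV] at hNcard
  have hdn : d ≤ n := by
    rw [← hA]
    exact A.rank_le_height
  refine (measureReal_forall_net_ge hG (by omega) hu hind N (fun y => (y : Fin n → ℝ))
    (fun y hy h0 => ?_) hK (card_mul_exp_le hn hd hNcard)).trans (measureReal_mono ?_)
  · have := hN1 y hy
    rw [Submodule.coe_norm, h0, norm_zero] at this
    exact zero_ne_one this
  · rintro ω ⟨hω1, hω2⟩ x
    rw [mulVec_diagonal_inv fun i => lt_of_le_of_lt (by positivity) (hω1 i)]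
    have h := orliczNorm_le_of_net hG (by omega) hω1 hK (by positivity) (net_radius_bound hn hdn) V N
      hNnet hN1 hω2 (LinearMap.mem_range_self A.mulVecLin x)
    rw [Matrix.mulVecLin_apply] at h
    refine le_of_eq_of_le ?_ h
    have : 0 < Real.log n := by linarith
    field_simp
    ring
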